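/- Let $N\ge 2$ and let $\Omega\subset\mathbb{R}^N$ be a bounded open set. For $0<s<1<p<N$ put $$c_{N,s,p}:=\frac{s\,2^{2s}\,\Gamma\!\left(\frac{ps+p+N-2}{2}\right)}{\pi^{N/2}\,\Gamma(1-s)},$$ and for measurable $u:\mathbb{R}^N\to\mathbb{R}$ let $[u]_{s,p}\in[0,\infty]$ be $$[u]_{0,p}:=\|u\|_{L^p(\mathbb{R}^N)},\qquad [u]_{s,p}:=\left(c_{N,s,p}\iint_{\mathbb{R}^{2N}}\frac{|u(x)-u(y)|^p}{|x-y|^{N+sp}}\,dx\,dy\right)^{1/p}\ (0<s<1),\qquad [u]_{1,p}:=\|\nabla u\|_{L^p(\mathbb{R}^N)},$$ where $\nabla u$ is the weak gradient and $[u]_{1,p}:=\infty$ if $u$ has no weak gradient in $L^1_{\rm loc}$. There exists a constant $c_0=c_0(N,\Omega)>0$ with the following property. Let $\overline s\in(0,1]$, let $\mu_s^+,\mu_s^-$ be finite Borel measures on $[0,1]$ and $\mu_p$ a finite Borel measure on $(1,N)$, and set $$\mu^+:=\mu_s^+\times\mu_p,\qquad \mu^-:=\mu_s^-\times\mu_p,\qquad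 \mu:=\mu^+-\mu^- .$$ Assume that $\mu^+([\overline s,1]\times(1,N))>0$ and $\mu^-([\overline s,1]\times(1,N))=0$, and that for some $\gamma\ge 0$ and $\delta,\eta>0$, $$\mu_s^-([0,\overline s))\le\gamma\,\mu_s^+([\overline s,1])\qquad\text{and}\qquad \operatorname{supp}(\mu_p)\subset[1+\delta,N-\eta].$$ Let $\mathcal{X}_\mu(\Omega)$ be the completion of $C_c^\infty(\Omega)$ with respect to the norm $\|u\|_\mu:=\iint_{[0,1]\times(1,N)}[u]_{s,p}\,d\mu^+(s,p)$, that is, the space of measurable functions $u$ on $\mathbb{R}^N$ with $u=0$ a.e. outside $\Omega$ for which there are $\varphi_k\in C_c^\infty(\Omega)$ with $\|\varphi_k-u\|_\mu\to0$. Then, for every $u\in\mathcal{X}_\mu(\Omega)$, as an inequality in $[0,\infty]$, $$\iint_{[0,\overline s)\times(1,N)}[u]_{s,p}^p\,d\mu^-(s,p)\le c_0\,\gamma\iint_{[\overline s,1]\times(1,N)}[u]_{s,p}^p\,d\mu(s,p).$$ -/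

import Mathlib

open MeasureTheory Set Filter Topology
open scoped ENNReal ContDiff

noncomputable section

/-- The normalizing constant
`c_{N,s,p} = s 2^{2s} Γ((ps+p+N-2)/2) / (π^{N/2} Γ(1-s))`, used for `0 < s < 1`, `1 < p < N`. -/
def cNsp (N : ℕ) (s p : ℝ) : ℝ :=
  s * (2 : ℝ) ^ (2 * s) * Real.Gamma ((p * s + p + (N : ℝ) - 2) / 2) /
    (Real.pi ^ ((N : ℝ) / 2) * Real.Gamma (1 - s))

/-- `φ ∈ C_c^∞(Ω)`, as a function on all of `ℝ^N`. -/
def IsTestFunction {N : ℕ} (Ω : Set (EuclideanSpace ℝ (Fin N)))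
    (φ : EuclideanSpace ℝ (Fin N) → ℝ) : Prop :=
  ContDiff ℝ ∞ φ ∧ HasCompactSupport φ ∧ tsupport φ ⊆ Ω

/-- `G ∈ L^1_loc(ℝ^N; ℝ^N)` is the weak gradient of `u ∈ L^1_loc(ℝ^N)` on the whole space. -/
def HasWeakGradient {N : ℕ} (u : EuclideanSpace ℝ (Fin N) → ℝ)
    (G : EuclideanSpace ℝ (Fin N) → EuclideanSpace ℝ (Fin N)) : Prop :=
  LocallyIntegrable u volume ∧ LocallyIntegrable G volume ∧
    ∀ φ : EuclideanSpace ℝ (Fin N) → ℝ, IsTestFunction univ φ →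
      ∀ v : EuclideanSpace ℝ (Fin N),
        ∫ x, u x * fderiv ℝ φ x v = - ∫ x, φ x * inner ℝ (G x) v

/-- `‖∇u‖_{L^p(ℝ^N)}` for the weak gradient, with value `∞` if `u` has none. The weak gradient is
unique up to null sets, so the infimum runs over one value or over none. -/
def gradNorm {N : ℕ} (p : ℝ) (u : EuclideanSpace ℝ (Fin N) → ℝ) : ℝ≥0∞ :=
  ⨅ (G : EuclideanSpace ℝ (Fin N) → EuclideanSpace ℝ (Fin N)) (_ : HasWeakGradient u G),
    eLpNorm G (ENNReal.ofReal p) volume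

/-- The quantity `[u]_{s,p} ∈ [0,∞]`, for `0 ≤ s ≤ 1` and `1 < p`. -/
def fracSeminorm {N : ℕ} (s p : ℝ) (u : EuclideanSpace ℝ (Fin N) → ℝ) : ℝ≥0∞ :=
  if s = 0 then eLpNorm u (ENNReal.ofReal p) volume
  else if s = 1 then gradNorm p u
  else
    (ENNReal.ofReal (cNsp N s p) *
      ∫⁻ z : EuclideanSpace ℝ (Fin N) × EuclideanSpace ℝ (Fin N),
        ENNReal.ofReal (|u z.1 - u z.2| ^ p / ‖z.1 - z.2‖ ^ ((N : ℝ) + s * p))) ^ (1 / p)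

/-- `‖u‖_μ = ∬_Σ [u]_{s,p} dμ⁺(s,p)` with `Σ = [0,1] × (1,N)`; the variables are `(s,p)`. -/
def muNorm {N : ℕ} (μplus : Measure (ℝ × ℝ)) (u : EuclideanSpace ℝ (Fin N) → ℝ) : ℝ≥0∞ :=
  ∫⁻ z in Icc (0 : ℝ) 1 ×ˢ Ioo (1 : ℝ) N, fracSeminorm z.1 z.2 u ∂μplus

/-- The space `X_μ(Ω)`, the completion of `C_c^∞(Ω)` for `‖·‖_μ`, realized as a space of
functions: those vanishing a.e. outside `Ω` that are limits in `‖·‖_μ` of functions in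
`C_c^∞(Ω)`. (Its elements are representatives; functions that agree a.e. are identified.) -/
def spaceX {N : ℕ} (Ω : Set (EuclideanSpace ℝ (Fin N))) (μplus : Measure (ℝ × ℝ)) :
    Set (EuclideanSpace ℝ (Fin N) → ℝ) :=
  {u | AEStronglyMeasurable u volume ∧ (∀ᵐ x ∂volume, x ∉ Ω → u x = 0) ∧
    ∃ φ : ℕ → EuclideanSpace ℝ (Fin N) → ℝ, (∀ k, IsTestFunction Ω (φ k)) ∧
      Tendsto (fun k => muNorm μplus (φ k - u)) atTop (𝓝 0)}

/-- The integral over `A` of a `[0,∞]`-valued function against a signed measure `μ`: the difference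
of the integrals against the two parts of the Jordan decomposition of `μ`. It is meaningful
as soon as one of the two is finite. -/
def signedIntegral {α : Type*} [MeasurableSpace α] (μ : SignedMeasure α) (A : Set α)
    (f : α → ℝ≥0∞) : EReal :=
  ((∫⁻ z in A, f z ∂μ.toJordanDecomposition.posPart : ℝ≥0∞) : EReal) -
    ((∫⁻ z in A, f z ∂μ.toJordanDecomposition.negPart : ℝ≥0∞) : EReal)

end

/-!
Let `τ h = ∫ |u (x + h) - u x| ^ p dx`, and let `V k` be the mass of `τ` on the dyadic shell
`2 ^ k r < |h| ≤ 2 ^ (k + 1) r`, rescaled to the shell `k = 0`. As `c_{N,s,p}` is comparable to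
`s (1 - s)`, the power `[u]_{s,p} ^ p` is comparable to `s (1 - s) ∑ 2 ^ (-k p s) V k`. If `u`
vanishes outside the ball of radius `r / 2`, then `V k` is comparable to `a = ‖u‖_p ^ p` for
`k ≥ 0`, and these shells contribute `(1 - s) a`. On the shells `k = -n ≤ 0` the inequality
`τ (2 h) ≤ 2 ^ p τ h` makes `f n = 2 ^ (n p) V (-n)` nondecreasing, and they contribute `s` times
the Abel mean `A = (1 - q) ∑ q ^ n f n` with `q = 2 ^ (-p (1 - s))`. The Abel mean of a
nondecreasing sequence increases with `q` and is at least `f 0 ≥ a`, so `s A + (1 - s) a` increases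
with `s`. For `s = 0` it is `a`, and for `s = 1` it is bounded by a multiple of `‖∇u‖_p ^ p`, since
`τ h ≤ |h| ^ p ‖∇u‖_p ^ p`. Hence `[u]_{s,p} ^ p ≤ C [u]_{S,p} ^ p` for `s < S`, uniformly in `s`,
`S` and `p`, and this is integrated against the product measures.
-/

/-! ### Abel means and dyadic sums -/

section AbelMean

/-- The Abel mean `(1 - q) ∑ q ^ n * f n` of a nondecreasing sequence `f`. It is encoded through its
summation by parts, so that it is monotone in `q` and also makes sense for `q = 1`, where it is
`⨆ n, f n`. -/
noncomputable def abelMean (f : ℕ → ℝ≥0∞) (q : ℝ≥0∞) : ℝ≥0∞ :=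
  f 0 + ∑' j, q ^ (j + 1) * (f (j + 1) - f j)

variable {f : ℕ → ℝ≥0∞} {q r M : ℝ≥0∞}

lemma abelMean_mono (hqr : q ≤ r) : abelMean f q ≤ abelMean f r := by
  unfold abelMean
  gcongr

lemma apply_zero_le_abelMean : f 0 ≤ abelMean f q :=
  le_self_add

lemma add_sum_range_tsub (hf : Monotone f) (n : ℕ) :
    f 0 + ∑ j ∈ Finset.range n, (f (j + 1) - f j) = f n := by
  induction n with
  | zero => simp
  | succ n ih => rw [Finset.sum_range_succ, ← add_assoc, ih, add_tsub_cancel_of_le (hf n.le_succ)]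

lemma abelMean_le (hf : Monotone f) (hq : q ≤ 1) (hM : ∀ n, f n ≤ M) : abelMean f q ≤ M := by
  refine (abelMean_mono hq).trans ?_
  simp only [abelMean, one_pow, one_mul]
  rw [ENNReal.tsum_eq_iSup_nat, ENNReal.add_iSup]
  exact iSup_le fun n => (add_sum_range_tsub hf n).trans_le (hM n)

lemma one_sub_mul_inv_cancel (hq : q < 1) : (1 - q) * (1 - q)⁻¹ = 1 :=
  ENNReal.mul_inv_cancel (tsub_pos_of_lt hq).ne' (by simp)

lemma tsum_pow_mul_sum_range (g : ℕ → ℝ≥0∞) :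
    ∑' n, q ^ n * ∑ j ∈ Finset.range n, g j = (1 - q)⁻¹ * ∑' j, q ^ (j + 1) * g j := by
  have swap : ∑' n, q ^ n * ∑ j ∈ Finset.range n, g j =
      ∑' j, ∑' n, if j < n then q ^ n * g j else 0 := by
    rw [ENNReal.tsum_comm]
    refine tsum_congr fun n => ?_
    rw [Finset.mul_sum, tsum_eq_sum (s := Finset.range n) (by simp +contextual)]
    exact Finset.sum_congr rfl fun j hj => (if_pos (Finset.mem_range.mp hj)).symm
  rw [swap, ← ENNReal.tsum_mul_left]
  refine tsum_congr fun j => ?_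
  rw [← ENNReal.summable.sum_add_tsum_nat_add' (k := j + 1),
    Finset.sum_eq_zero (by simp +contextual), zero_add, ← ENNReal.tsum_geometric,
    ← ENNReal.tsum_mul_right]
  refine tsum_congr fun n => ?_
  rw [if_pos (by omega), pow_add, mul_assoc]

lemma one_sub_mul_tsum_pow_mul (hf : Monotone f) (hq : q < 1) :
    (1 - q) * ∑' n, q ^ n * f n = abelMean f q := by
  calc (1 - q) * ∑' n, q ^ n * f n
      = (1 - q) * ∑' n, (q ^ n * f 0 + q ^ n * ∑ j ∈ Finset.range n, (f (j + 1) - f j)) := by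
        simp only [← mul_add, add_sum_range_tsub hf]
    _ = (1 - q) * ((1 - q)⁻¹ * abelMean f q) := by
        rw [ENNReal.tsum_add, tsum_pow_mul_sum_range, ENNReal.tsum_mul_right,
          ENNReal.tsum_geometric, ← mul_add, abelMean]
    _ = abelMean f q := by rw [← mul_assoc, one_sub_mul_inv_cancel hq, one_mul]

end AbelMean

lemma two_rpow_add (x y : ℝ) : (2 : ℝ≥0∞) ^ (x + y) = 2 ^ x * 2 ^ y :=
  ENNReal.rpow_add x y (by simp) (by simp)

lemma two_rpow_le_two_rpow {x y : ℝ} (hxy : x ≤ y) : (2 : ℝ≥0∞) ^ x ≤ 2 ^ y :=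
  ENNReal.rpow_le_rpow_of_exponent_le (by norm_num) hxy

lemma two_rpow_neg_lt_one {x : ℝ} (hx : 0 < x) : (2 : ℝ≥0∞) ^ (-x) < 1 :=
  ENNReal.rpow_lt_one_of_one_lt_of_neg (by norm_num) (by linarith)

lemma ofReal_two_rpow (x : ℝ) : ENNReal.ofReal ((2 : ℝ) ^ x) = (2 : ℝ≥0∞) ^ x := by
  rw [← ENNReal.ofReal_rpow_of_pos (by norm_num), ENNReal.ofReal_ofNat]

lemma one_sub_two_rpow_neg (x : ℝ) :
    1 - (2 : ℝ≥0∞) ^ (-x) = ENNReal.ofReal (1 - (2 : ℝ) ^ (-x)) := by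
  rw [ENNReal.ofReal_sub _ (by positivity), ENNReal.ofReal_one, ofReal_two_rpow]

lemma one_sub_two_rpow_neg_le {x : ℝ} (hx : 0 ≤ x) :
    1 - (2 : ℝ≥0∞) ^ (-x) ≤ ENNReal.ofReal x := by
  rw [one_sub_two_rpow_neg]
  refine ENNReal.ofReal_le_ofReal ?_
  have h_exp := Real.one_sub_le_exp_neg (Real.log 2 * x)
  rw [← mul_neg, ← Real.rpow_def_of_pos two_pos] at h_exp
  nlinarith [Real.log_two_lt_d9]

lemma ofReal_le_two_mul_one_sub_two_rpow_neg {t x : ℝ} (ht₀ : 0 ≤ t) (ht₁ : t ≤ 1) (htx : t ≤ x) :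
    ENNReal.ofReal t ≤ 2 * (1 - (2 : ℝ≥0∞) ^ (-x)) := by
  have bernoulli : (2 : ℝ) ^ (-t) ≤ 1 + t * (-1 / 2) := by
    have := rpow_one_add_le_one_add_mul_self (s := -1 / 2) (by norm_num) ht₀ ht₁
    rwa [show (1 : ℝ) + -1 / 2 = 2⁻¹ by norm_num, Real.inv_rpow zero_le_two,
      ← Real.rpow_neg zero_le_two] at this
  have h_mono : (2 : ℝ) ^ (-x) ≤ 2 ^ (-t) :=
    Real.rpow_le_rpow_of_exponent_le one_le_two (neg_le_neg htx)
  rw [one_sub_two_rpow_neg, ← ENNReal.ofReal_ofNat 2, ← ENNReal.ofReal_mul zero_le_two]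
  exact ENNReal.ofReal_le_ofReal (by linarith)

/-- The sum of `V k / 2 ^ (k p s)` over all dyadic scales `2 ^ k`. -/
noncomputable def dyadicSum (V : ℤ → ℝ≥0∞) (s p : ℝ) : ℝ≥0∞ :=
  ∑' k : ℤ, (2 : ℝ≥0∞) ^ (-(k * (p * s))) * V k

/-- The values of `V` at the scales `2 ^ (-n)`, normalized for the exponent `p` of order one. -/
noncomputable def smallScales (V : ℤ → ℝ≥0∞) (p : ℝ) (n : ℕ) : ℝ≥0∞ :=
  (2 : ℝ≥0∞) ^ (n * p) * V (-n)

/-- A quantity comparable to `s (1 - s)` times the dyadic sum of order `s`: the small scales enter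
through an Abel mean, the large ones through their common size `a`. It extends to the endpoints
`s = 0` and `s = 1`. -/
noncomputable def dyadicMean (V : ℤ → ℝ≥0∞) (a : ℝ≥0∞) (s p : ℝ) : ℝ≥0∞ :=
  ENNReal.ofReal s * abelMean (smallScales V p) (2 ^ (-(p * (1 - s)))) + ENNReal.ofReal (1 - s) * a

section Dyadic

variable {V : ℤ → ℝ≥0∞} {a M : ℝ≥0∞} {s S p P : ℝ}

lemma monotone_smallScales (hV : ∀ k, V (k + 1) ≤ 2 ^ p * V k) : Monotone (smallScales V p) := by
  refine monotone_nat_of_le_succ fun n => ?_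
  have h := hV (-(n + 1 : ℕ))
  rw [show -((n + 1 : ℕ) : ℤ) + 1 = -n by push_cast; ring] at h
  calc (2 : ℝ≥0∞) ^ (n * p) * V (-n) ≤ 2 ^ (n * p) * (2 ^ p * V (-(n + 1 : ℕ))) := by gcongr
    _ = 2 ^ ((n + 1 : ℕ) * p) * V (-(n + 1 : ℕ)) := by
      rw [← mul_assoc, ← two_rpow_add, ← add_one_mul]
      norm_cast

lemma dyadicSum_eq_add (V : ℤ → ℝ≥0∞) (s p : ℝ) :
    dyadicSum V s p = ∑' n : ℕ, ((2 : ℝ≥0∞) ^ (-(p * (1 - s)))) ^ n * smallScales V p n +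
      ∑' n : ℕ, ((2 : ℝ≥0∞) ^ (-(p * s))) ^ (n + 1) * V (n + 1) := by
  rw [dyadicSum, ← (Equiv.neg ℤ).tsum_eq,
    tsum_of_nat_of_neg_add_one ENNReal.summable ENNReal.summable]
  simp only [Equiv.neg_apply, neg_neg, smallScales, ← mul_assoc, ← ENNReal.rpow_mul_natCast,
    ← two_rpow_add]
  congr! 5 <;> push_cast <;> ring

lemma dyadicMean_zero : dyadicMean V a 0 p = a := by
  simp [dyadicMean]

lemma dyadicMean_one_le (hV : Monotone (smallScales V p)) (hM : ∀ n, smallScales V p n ≤ M) :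
    dyadicMean V a 1 p ≤ M := by
  simpa [dyadicMean] using abelMean_le hV le_rfl hM

lemma dyadicMean_mono (hp : 0 ≤ p) (hs : 0 ≤ s) (hsS : s ≤ S) (hS : S ≤ 1) (ha : a ≤ V 0) :
    dyadicMean V a s p ≤ dyadicMean V a S p := by
  have hA : abelMean (smallScales V p) (2 ^ (-(p * (1 - s)))) ≤
      abelMean (smallScales V p) (2 ^ (-(p * (1 - S)))) :=
    abelMean_mono (two_rpow_le_two_rpow (by gcongr))
  have haA : a ≤ abelMean (smallScales V p) (2 ^ (-(p * (1 - S)))) :=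
    ha.trans ((by simp [smallScales] : V 0 ≤ smallScales V p 0).trans apply_zero_le_abelMean)
  calc dyadicMean V a s p
      = ENNReal.ofReal s * abelMean (smallScales V p) (2 ^ (-(p * (1 - s)))) +
          (ENNReal.ofReal (S - s) * a + ENNReal.ofReal (1 - S) * a) := by
        rw [dyadicMean, ← add_mul, ← ENNReal.ofReal_add (by linarith) (by linarith),
          sub_add_sub_cancel']
    _ ≤ ENNReal.ofReal s * abelMean (smallScales V p) (2 ^ (-(p * (1 - S)))) +
          (ENNReal.ofReal (S - s) * abelMean (smallScales V p) (2 ^ (-(p * (1 - S)))) +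
            ENNReal.ofReal (1 - S) * a) := by gcongr
    _ = dyadicMean V a S p := by
        rw [dyadicMean, ← add_assoc, ← add_mul, ← ENNReal.ofReal_add hs (by linarith),
          add_sub_cancel]

lemma ofReal_one_sub_mul_tsum_smallScales_le (hp : 1 ≤ p) (hs₀ : 0 ≤ s) (hs₁ : s < 1)
    (hV : ∀ k, V (k + 1) ≤ 2 ^ p * V k) :
    ENNReal.ofReal (1 - s) * ∑' n : ℕ, ((2 : ℝ≥0∞) ^ (-(p * (1 - s)))) ^ n * smallScales V p n ≤
      2 * abelMean (smallScales V p) (2 ^ (-(p * (1 - s)))) := by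
  rw [← one_sub_mul_tsum_pow_mul (monotone_smallScales hV)
    (two_rpow_neg_lt_one (mul_pos (by linarith) (by linarith))), ← mul_assoc]
  gcongr
  exact ofReal_le_two_mul_one_sub_two_rpow_neg (by linarith) (by linarith)
    (le_mul_of_one_le_left (by linarith) hp)

lemma abelMean_smallScales_le (hp : 0 < p) (hpP : p ≤ P) (hs : s < 1)
    (hV : ∀ k, V (k + 1) ≤ 2 ^ p * V k) :
    abelMean (smallScales V p) (2 ^ (-(p * (1 - s)))) ≤ ENNReal.ofReal P * (ENNReal.ofReal (1 - s) *
      ∑' n : ℕ, ((2 : ℝ≥0∞) ^ (-(p * (1 - s)))) ^ n * smallScales V p n) := by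
  have hps : 0 < p * (1 - s) := mul_pos hp (by linarith)
  rw [← one_sub_mul_tsum_pow_mul (monotone_smallScales hV) (two_rpow_neg_lt_one hps), ← mul_assoc,
    ← ENNReal.ofReal_mul (hp.le.trans hpP)]
  gcongr
  refine (one_sub_two_rpow_neg_le hps.le).trans (ENNReal.ofReal_le_ofReal ?_)
  gcongr

lemma ofReal_mul_tsum_largeScales_le (hp : 1 ≤ p) (hs₀ : 0 < s) (hs₁ : s ≤ 1)
    (hVa : ∀ n : ℕ, V n ≤ 2 ^ P * a) :
    ENNReal.ofReal s * ∑' n : ℕ, ((2 : ℝ≥0∞) ^ (-(p * s))) ^ (n + 1) * V (n + 1) ≤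
      2 * (2 ^ P * a) := by
  set q := (2 : ℝ≥0∞) ^ (-(p * s))
  have hq : q < 1 := two_rpow_neg_lt_one (by positivity)
  calc ENNReal.ofReal s * ∑' n : ℕ, q ^ (n + 1) * V (n + 1)
      ≤ 2 * (1 - q) * ∑' n : ℕ, q ^ n * (2 ^ P * a) := by
        gcongr ?_ * ∑' n, ?_ * ?_ with n
        · exact ofReal_le_two_mul_one_sub_two_rpow_neg hs₀.le hs₁
            (le_mul_of_one_le_left hs₀.le hp)
        · exact pow_le_pow_right_of_le_one' hq.le n.le_succ
        · exact_mod_cast hVa (n + 1)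
    _ = 2 * (2 ^ P * a) := by
        rw [ENNReal.tsum_mul_right, ENNReal.tsum_geometric, mul_assoc, ← mul_assoc (1 - q),
          one_sub_mul_inv_cancel hq, one_mul]

lemma le_mul_tsum_largeScales (hp : 0 < p) (hpP : p ≤ P) (hs₀ : 0 < s) (hs₁ : s ≤ 1)
    (haV : ∀ n : ℕ, a ≤ V n) :
    a ≤ ENNReal.ofReal P * 2 ^ P *
      (ENNReal.ofReal s * ∑' n : ℕ, ((2 : ℝ≥0∞) ^ (-(p * s))) ^ (n + 1) * V (n + 1)) := by
  have hps : p * s ≤ P := by nlinarith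
  set q := (2 : ℝ≥0∞) ^ (-(p * s)) with q_def
  have hq : q < 1 := two_rpow_neg_lt_one (by positivity)
  have one_le : 1 ≤ 2 ^ P * q := by
    rw [q_def, ← two_rpow_add, ← ENNReal.rpow_zero (x := 2)]
    exact two_rpow_le_two_rpow (by linarith)
  have one_sub_le : 1 - q ≤ ENNReal.ofReal P * ENNReal.ofReal s := by
    rw [← ENNReal.ofReal_mul (hp.le.trans hpP)]
    refine (one_sub_two_rpow_neg_le (by positivity)).trans (ENNReal.ofReal_le_ofReal ?_)
    gcongr
  calc a = 1 * ((1 - q) * ∑' n : ℕ, q ^ n * a) := by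
        rw [ENNReal.tsum_mul_right, ENNReal.tsum_geometric, ← mul_assoc (1 - q),
          one_sub_mul_inv_cancel hq, one_mul, one_mul]
    _ ≤ 2 ^ P * q * (ENNReal.ofReal P * ENNReal.ofReal s * ∑' n : ℕ, q ^ n * V (n + 1)) := by
        gcongr with n
        exact_mod_cast haV (n + 1)
    _ = _ := by
        simp only [pow_succ', mul_assoc q, ENNReal.tsum_mul_left]
        ring

lemma ofReal_mul_dyadicSum_le (hp : 1 ≤ p) (hP : 0 ≤ P) (hs₀ : 0 < s) (hs₁ : s < 1)
    (hV : ∀ k, V (k + 1) ≤ 2 ^ p * V k) (hVa : ∀ n : ℕ, V n ≤ 2 ^ P * a) :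
    ENNReal.ofReal (s * (1 - s)) * dyadicSum V s p ≤ 2 * 2 ^ P * dyadicMean V a s p := by
  have h_small := ofReal_one_sub_mul_tsum_smallScales_le hp hs₀.le hs₁ hV
  have h_large := ofReal_mul_tsum_largeScales_le hp hs₀ hs₁.le hVa
  have one_le : (1 : ℝ≥0∞) ≤ 2 ^ P := by simpa using two_rpow_le_two_rpow hP
  rw [dyadicSum_eq_add, dyadicMean, ENNReal.ofReal_mul hs₀.le]
  set X := ∑' n : ℕ, ((2 : ℝ≥0∞) ^ (-(p * (1 - s)))) ^ n * smallScales V p n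
  set Y := ∑' n : ℕ, ((2 : ℝ≥0∞) ^ (-(p * s))) ^ (n + 1) * V (n + 1)
  set A := abelMean (smallScales V p) (2 ^ (-(p * (1 - s))))
  calc ENNReal.ofReal s * ENNReal.ofReal (1 - s) * (X + Y)
      = ENNReal.ofReal s * (ENNReal.ofReal (1 - s) * X) +
          ENNReal.ofReal (1 - s) * (ENNReal.ofReal s * Y) := by ring
    _ ≤ ENNReal.ofReal s * (2 * (2 ^ P * A)) + ENNReal.ofReal (1 - s) * (2 * (2 ^ P * a)) := by
        gcongr _ * ?_ + _ * ?_
        exact h_small.trans (mul_le_mul_right (le_mul_of_one_le_left' one_le) _)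
    _ = 2 * 2 ^ P * (ENNReal.ofReal s * A + ENNReal.ofReal (1 - s) * a) := by ring

lemma dyadicMean_le (hp : 0 < p) (hpP : p ≤ P) (hs₀ : 0 < s) (hs₁ : s < 1)
    (hV : ∀ k, V (k + 1) ≤ 2 ^ p * V k) (haV : ∀ n : ℕ, a ≤ V n) :
    dyadicMean V a s p ≤
      ENNReal.ofReal P * 2 ^ P * (ENNReal.ofReal (s * (1 - s)) * dyadicSum V s p) := by
  have h_small := abelMean_smallScales_le hp hpP hs₁ hV
  have h_large := le_mul_tsum_largeScales hp hpP hs₀ hs₁.le haV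
  have one_le : (1 : ℝ≥0∞) ≤ 2 ^ P := by simpa using two_rpow_le_two_rpow (hp.le.trans hpP)
  rw [dyadicSum_eq_add, dyadicMean, ENNReal.ofReal_mul hs₀.le]
  set X := ∑' n : ℕ, ((2 : ℝ≥0∞) ^ (-(p * (1 - s)))) ^ n * smallScales V p n
  set Y := ∑' n : ℕ, ((2 : ℝ≥0∞) ^ (-(p * s))) ^ (n + 1) * V (n + 1)
  calc _ ≤ ENNReal.ofReal s * (ENNReal.ofReal P * (2 ^ P * (ENNReal.ofReal (1 - s) * X))) +
          ENNReal.ofReal (1 - s) * (ENNReal.ofReal P * 2 ^ P * (ENNReal.ofReal s * Y)) := by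
        gcongr _ * ?_ + _ * ?_
        exact h_small.trans (mul_le_mul_right (le_mul_of_one_le_left' one_le) _)
    _ = ENNReal.ofReal P * 2 ^ P * (ENNReal.ofReal s * ENNReal.ofReal (1 - s) * (X + Y)) := by ring

end Dyadic

/-! ### Translations and the Gagliardo integral -/

section Translation

variable {E F : Type*} [NormedAddCommGroup E] [MeasurableSpace E] [NormedAddCommGroup F]

/-- The `p`-th power of the `L^p` norm of `u (· + h) - u`. -/
noncomputable def translateMass (μ : Measure E) (u : E → F) (p : ℝ) (h : E) : ℝ≥0∞ :=
  ∫⁻ x, ‖u (x + h) - u x‖ₑ ^ p ∂μ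

variable (E) in
/-- The dyadic annulus `r < ‖h‖ ≤ 2 r`, whose images under the dilations by `2 ^ k` partition the
punctured space. -/
def annulus (r : ℝ) : Set E := {h | ‖h‖ ∈ Ioc r (2 * r)}

variable {μ : Measure E} {u : E → F} {p P s S r : ℝ}

lemma lintegral_enorm_add_rpow_le {α : Type*} [MeasurableSpace α] {μ : Measure α} {f g : α → F}
    {A : ℝ≥0∞} (hg : AEStronglyMeasurable g μ) (hp : 1 ≤ p) (hfA : ∫⁻ x, ‖f x‖ₑ ^ p ∂μ ≤ A)
    (hgA : ∫⁻ x, ‖g x‖ₑ ^ p ∂μ ≤ A) : ∫⁻ x, ‖f x + g x‖ₑ ^ p ∂μ ≤ 2 ^ p * A := by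
  calc ∫⁻ x, ‖f x + g x‖ₑ ^ p ∂μ ≤ ∫⁻ x, 2 ^ (p - 1) * (‖f x‖ₑ ^ p + ‖g x‖ₑ ^ p) ∂μ := by
        refine lintegral_mono fun x => ?_
        exact (ENNReal.rpow_le_rpow (enorm_add_le _ _) (by linarith)).trans
          (ENNReal.rpow_add_le_mul_rpow_add_rpow _ _ hp)
    _ = 2 ^ (p - 1) * (∫⁻ x, ‖f x‖ₑ ^ p ∂μ + ∫⁻ x, ‖g x‖ₑ ^ p ∂μ) := by
        rw [lintegral_const_mul' _ _ (by finiteness), lintegral_add_right' _ (hg.enorm.pow_const p)]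
    _ ≤ 2 ^ (p - 1) * (2 ^ (1 : ℝ) * A) := by
        rw [ENNReal.rpow_one, two_mul]
        gcongr
    _ = 2 ^ p * A := by rw [← mul_assoc, ← two_rpow_add, sub_add_cancel]

lemma measure_annulus_ne_top [ProperSpace E] [IsFiniteMeasureOnCompacts μ] :
    μ (annulus E r) ≠ ⊤ :=
  measure_ne_top_of_subset (fun _ hh => mem_closedBall_zero_iff.2 hh.2)
    (measure_closedBall_lt_top (x := (0 : E)) (r := 2 * r)).ne

lemma measure_annulus_ne_zero [NormedSpace ℝ E] [Nontrivial E] [μ.IsOpenPosMeasure]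
    (hr : 0 < r) : μ (annulus E r) ≠ 0 := by
  obtain ⟨x, hx⟩ := exists_norm_eq E (c := 3 / 2 * r) (by positivity)
  have h_open : IsOpen {h : E | ‖h‖ ∈ Ioo r (2 * r)} := isOpen_Ioo.preimage continuous_norm
  have hx_mem : ‖x‖ ∈ Ioo r (2 * r) := by constructor <;> linarith
  have h_subset : {h : E | ‖h‖ ∈ Ioo r (2 * r)} ⊆ annulus E r := fun h hh => ⟨hh.1, hh.2.le⟩
  exact ((h_open.measure_pos μ ⟨x, hx_mem⟩).trans_le (measure_mono h_subset)).ne'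

variable [BorelSpace E]

lemma measurableSet_annulus : MeasurableSet (annulus E r) :=
  measurable_norm measurableSet_Ioc

section AddRightInvariant

variable [μ.IsAddRightInvariant]

lemma aestronglyMeasurable_comp_add_right (hu : AEStronglyMeasurable u μ) (h : E) :
    AEStronglyMeasurable (fun x => u (x + h)) μ :=
  hu.comp_measurePreserving (measurePreserving_add_right μ h)

lemma translateMass_add_self_le (hu : AEStronglyMeasurable u μ) (hp : 1 ≤ p) (h : E) :
    translateMass μ u p (h + h) ≤ 2 ^ p * translateMass μ u p h := by
  have h_split : translateMass μ u p (h + h) =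
      ∫⁻ x, ‖(u (x + h + h) - u (x + h)) + (u (x + h) - u x)‖ₑ ^ p ∂μ := by
    simp only [translateMass, add_assoc, sub_add_sub_cancel]
  rw [h_split]
  refine lintegral_enorm_add_rpow_le ((aestronglyMeasurable_comp_add_right hu h).sub hu) hp ?_
    le_rfl
  exact (lintegral_add_right_eq_self (fun x => ‖u (x + h) - u x‖ₑ ^ p) h).le

lemma translateMass_le (hu : AEStronglyMeasurable u μ) (hp : 1 ≤ p) (h : E) :
    translateMass μ u p h ≤ 2 ^ p * ∫⁻ x, ‖u x‖ₑ ^ p ∂μ := by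
  simp only [translateMass, sub_eq_add_neg]
  refine lintegral_enorm_add_rpow_le hu.neg hp ?_ (by simp only [enorm_neg, le_refl])
  exact (lintegral_add_right_eq_self (fun x => ‖u x‖ₑ ^ p) h).le

lemma lintegral_le_translateMass (hp : 0 < p) (hu : ∀ᵐ x ∂μ, r / 2 ≤ ‖x‖ → u x = 0) {h : E}
    (hh : r < ‖h‖) : ∫⁻ x, ‖u x‖ₑ ^ p ∂μ ≤ translateMass μ u p h := by
  refine lintegral_mono_ae ?_
  filter_upwards [hu, (measurePreserving_add_right μ h).quasiMeasurePreserving.ae hu] with x hx hxh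
  by_cases hxr : r / 2 ≤ ‖x‖
  · simp [hx hxr, hp]
  · have : ‖h‖ ≤ ‖x + h‖ + ‖x‖ := by simpa using norm_sub_le (x + h) x
    rw [hxh (by linarith), zero_sub, enorm_neg]

variable [NormedSpace ℝ E]

/-- The integral of the translation mass over the annulus of radius `r`, at the scale `2 ^ k`. -/
noncomputable def shellMass (μ : Measure E) (u : E → F) (p r : ℝ) (k : ℤ) : ℝ≥0∞ :=
  ∫⁻ h in annulus E r, translateMass μ u p ((2 : ℝ) ^ k • h) ∂μ

/-- The Gagliardo double integral of order `s` and exponent `p`, without normalization. -/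
noncomputable def gagliardo (μ : Measure E) (s p : ℝ) (u : E → F) : ℝ≥0∞ :=
  ∫⁻ z : E × E, ENNReal.ofReal
    (‖u z.1 - u z.2‖ ^ p / ‖z.1 - z.2‖ ^ ((Module.finrank ℝ E : ℝ) + s * p)) ∂μ.prod μ

lemma shellMass_succ_le (hu : AEStronglyMeasurable u μ) (hp : 1 ≤ p) (k : ℤ) :
    shellMass μ u p r (k + 1) ≤ 2 ^ p * shellMass μ u p r k := by
  rw [shellMass, shellMass, ← lintegral_const_mul' _ _ (by finiteness)]
  refine lintegral_mono fun h => ?_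
  rw [zpow_add_one₀ two_ne_zero, mul_comm, mul_smul, two_smul]
  exact translateMass_add_self_le hu hp _

lemma shellMass_le (hu : AEStronglyMeasurable u μ) (hp : 1 ≤ p) (hpP : p ≤ P) (k : ℤ) :
    shellMass μ u p r k ≤ 2 ^ P * (μ (annulus E r) * ∫⁻ x, ‖u x‖ₑ ^ p ∂μ) := by
  calc shellMass μ u p r k ≤ ∫⁻ _ in annulus E r, 2 ^ P * ∫⁻ x, ‖u x‖ₑ ^ p ∂μ ∂μ :=
        lintegral_mono fun h =>
          (translateMass_le hu hp _).trans (mul_le_mul_left (two_rpow_le_two_rpow hpP) _)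
    _ = 2 ^ P * (μ (annulus E r) * ∫⁻ x, ‖u x‖ₑ ^ p ∂μ) := by
        rw [setLIntegral_const]
        ring

lemma le_shellMass (hp : 0 < p) (hu : ∀ᵐ x ∂μ, r / 2 ≤ ‖x‖ → u x = 0) (n : ℕ) :
    μ (annulus E r) * ∫⁻ x, ‖u x‖ₑ ^ p ∂μ ≤ shellMass μ u p r n := by
  rw [mul_comm, ← setLIntegral_const]
  refine setLIntegral_mono' measurableSet_annulus fun h hh => lintegral_le_translateMass hp hu ?_
  rw [norm_smul, zpow_natCast, norm_pow, Real.norm_ofNat]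
  exact hh.1.trans_le (le_mul_of_one_le_left (norm_nonneg h) (one_le_pow₀ one_le_two))

/-- The mean of the translation masses of `u` over the shells `2 ^ k r < ‖h‖ ≤ 2 ^ (k + 1) r`, with
the mass of `u` itself in place of the large scales. For `u` supported in a ball of radius `r / 2`
it is comparable to the `p`-th power of the seminorm of order `s`, and it is monotone in `s`. -/
noncomputable def shellMean (μ : Measure E) (u : E → F) (p r s : ℝ) : ℝ≥0∞ :=
  dyadicMean (shellMass μ u p r) (μ (annulus E r) * ∫⁻ x, ‖u x‖ₑ ^ p ∂μ) s p

lemma shellMean_mono (hp : 0 < p) (hu : ∀ᵐ x ∂μ, r / 2 ≤ ‖x‖ → u x = 0) (hs : 0 ≤ s) (hsS : s ≤ S)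
    (hS : S ≤ 1) : shellMean μ u p r s ≤ shellMean μ u p r S :=
  dyadicMean_mono hp.le hs hsS hS (le_shellMass hp hu 0)

end AddRightInvariant

variable [NormedSpace ℝ E]

lemma smallScales_shellMass_le {K : ℝ≥0∞} (hp : 0 ≤ p) (hpP : p ≤ P) (hr : 1 ≤ r)
    (hK : ∀ h, translateMass μ u p h ≤ ‖h‖ₑ ^ p * K) (n : ℕ) :
    smallScales (shellMass μ u p r) p n ≤
      μ (annulus E r) * (ENNReal.ofReal (2 * r) ^ P * K) := by
  rw [smallScales, shellMass, ← lintegral_const_mul' _ _ (by finiteness), mul_comm (μ _),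
    ← setLIntegral_const]
  refine setLIntegral_mono' measurableSet_annulus fun h hh => ?_
  have h_scale : (2 : ℝ≥0∞) ^ n * ‖(2 : ℝ) ^ (-n : ℤ) • h‖ₑ = ‖h‖ₑ := by
    have : ‖(2 : ℝ) ^ (-n : ℤ)‖ₑ = ((2 : ℝ≥0∞) ^ n)⁻¹ := by
      rw [← ofReal_norm, norm_zpow, Real.norm_ofNat, zpow_neg, zpow_natCast,
        ENNReal.ofReal_inv_of_pos (by positivity), ENNReal.ofReal_pow zero_le_two,
        ENNReal.ofReal_ofNat]
    rw [enorm_smul, this, ← mul_assoc, ENNReal.mul_inv_cancel (by simp) (by simp), one_mul]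
  calc (2 : ℝ≥0∞) ^ (n * p) * translateMass μ u p ((2 : ℝ) ^ (-n : ℤ) • h)
      ≤ (2 : ℝ≥0∞) ^ (n * p) * (‖(2 : ℝ) ^ (-n : ℤ) • h‖ₑ ^ p * K) := by
        gcongr
        exact hK _
    _ = ‖h‖ₑ ^ p * K := by
        rw [ENNReal.rpow_natCast_mul, ← mul_assoc, ← ENNReal.mul_rpow_of_nonneg _ _ hp, h_scale]
    _ ≤ ENNReal.ofReal (2 * r) ^ P * K := by
        have h_le : ‖h‖ₑ ≤ ENNReal.ofReal (2 * r) :=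
          ofReal_norm h ▸ ENNReal.ofReal_le_ofReal hh.2
        gcongr
        exact (ENNReal.rpow_le_rpow h_le hp).trans
          (ENNReal.rpow_le_rpow_of_exponent_le (ENNReal.one_le_ofReal.2 (by linarith)) hpP)

variable [FiniteDimensional ℝ E] [μ.IsAddHaarMeasure]

lemma gagliardo_eq_lintegral_translateMass (hu : AEStronglyMeasurable u μ) (hp : 0 ≤ p) :
    gagliardo μ s p u = ∫⁻ h, translateMass μ u p h *
      ENNReal.ofReal (‖h‖ ^ (-((Module.finrank ℝ E : ℝ) + s * p))) ∂μ := by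
  have h_meas : AEMeasurable (fun z : E × E => ENNReal.ofReal
      (‖u z.1 - u z.2‖ ^ p / ‖z.1 - z.2‖ ^ ((Module.finrank ℝ E : ℝ) + s * p))) (μ.prod μ) :=
    (((hu.comp_fst.sub hu.comp_snd).norm.aemeasurable.pow_const p).div
      ((measurable_fst.sub measurable_snd).norm.aemeasurable.pow_const _)).ennreal_ofReal
  have h_shear := measurePreserving_add_prod μ μ
  rw [gagliardo, ← h_shear.map_eq, lintegral_map' (h_shear.map_eq.symm ▸ h_meas)
    h_shear.aemeasurable]
  refine (lintegral_prod _ (h_meas.comp_quasiMeasurePreserving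
    h_shear.quasiMeasurePreserving)).trans ?_
  refine lintegral_congr fun h => ?_
  rw [translateMass, ← lintegral_mul_const' _ _ ENNReal.ofReal_ne_top]
  refine lintegral_congr fun x => ?_
  dsimp only [Function.comp_apply]
  rw [add_sub_cancel_right, Real.rpow_neg (norm_nonneg _), div_eq_mul_inv,
    ENNReal.ofReal_mul (by positivity), ← ENNReal.ofReal_rpow_of_nonneg (norm_nonneg _) hp,
    ofReal_norm, add_comm h x]

lemma setLIntegral_annulus_smul (k : ℤ) (g : E → ℝ≥0∞) :
    ∫⁻ h in annulus E (2 ^ k * r), g h ∂μ = (2 : ℝ≥0∞) ^ (k * Module.finrank ℝ E : ℝ) *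
      ∫⁻ h in annulus E r, g ((2 : ℝ) ^ k • h) ∂μ := by
  have h2k : (0 : ℝ) < 2 ^ k := by positivity
  have h_preimage : (fun h : E => (2 : ℝ) ^ k • h) ⁻¹' annulus E (2 ^ k * r) = annulus E r := by
    ext h
    simp only [annulus, mem_preimage, mem_ofPred_eq, norm_smul, norm_zpow, Real.norm_ofNat, mem_Ioc,
      mul_left_comm (2 : ℝ), mul_lt_mul_iff_right₀ h2k, mul_le_mul_iff_right₀ h2k]
  have h_emb : MeasurableEmbedding fun h : E => (2 : ℝ) ^ k • h :=
    measurableEmbedding_const_smul₀ h2k.ne'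
  rw [← h_preimage, ← h_emb.lintegral_map, ← h_emb.restrict_map, Measure.map_addHaar_smul μ h2k.ne',
    Measure.restrict_smul, lintegral_smul_measure, smul_eq_mul, ← mul_assoc,
    abs_of_pos (by positivity), ← Real.rpow_intCast, ← Real.rpow_mul_natCast zero_le_two,
    ← Real.rpow_neg zero_le_two, ofReal_two_rpow, ← two_rpow_add, add_neg_cancel, ENNReal.rpow_zero,
    one_mul]

lemma iUnion_annulus_ae_eq_univ [Nontrivial E] (hr : 0 < r) :
    ⋃ k : ℤ, annulus E (2 ^ k * r) =ᵐ[μ] univ := by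
  rw [ae_eq_univ]
  refine measure_mono_null (t := {0}) (fun h hh => ?_) (measure_singleton 0)
  by_contra hne
  obtain ⟨k, hk⟩ := exists_mem_Ioc_zpow (x := ‖h‖ / r) (y := (2 : ℝ))
    (div_pos (norm_pos_iff.mpr hne) hr) one_lt_two
  refine hh (mem_iUnion.mpr ⟨k, (lt_div_iff₀ hr).1 hk.1, ?_⟩)
  rw [← mul_assoc, ← zpow_one_add₀ two_ne_zero, add_comm]
  exact (div_le_iff₀ hr).1 hk.2

lemma lintegral_eq_tsum_annulus [Nontrivial E] (hr : 0 < r) (g : E → ℝ≥0∞) :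
    ∫⁻ h, g h ∂μ = ∑' k : ℤ, (2 : ℝ≥0∞) ^ (k * Module.finrank ℝ E : ℝ) *
      ∫⁻ h in annulus E r, g ((2 : ℝ) ^ k • h) ∂μ := by
  have h_disj : Pairwise (Function.onFun Disjoint fun k : ℤ => annulus E (2 ^ k * r)) := by
    have h_mono : Monotone fun k : ℤ => (2 : ℝ) ^ k * r := fun i j hij => by
      dsimp only
      gcongr
      exact one_le_two
    intro i j hij
    have := h_mono.pairwise_disjoint_on_Ioc_succ hij
    simp only [Function.onFun, Int.succ_eq_succ, Int.succ, zpow_add_one₀ (two_ne_zero' ℝ),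
      mul_comm _ (2 : ℝ), mul_assoc] at this
    exact this.preimage _
  rw [← setLIntegral_univ, ← setLIntegral_congr (iUnion_annulus_ae_eq_univ hr),
    lintegral_iUnion (fun _ => measurableSet_annulus) h_disj]
  exact tsum_congr fun k => setLIntegral_annulus_smul k g

lemma gagliardo_eq_tsum [Nontrivial E] (hr : 0 < r) (hu : AEStronglyMeasurable u μ) (hp : 0 ≤ p) :
    gagliardo μ s p u = ∑' k : ℤ, (2 : ℝ≥0∞) ^ (-(k * (p * s))) *
      ∫⁻ h in annulus E r, translateMass μ u p ((2 : ℝ) ^ k • h) *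
        ENNReal.ofReal (‖h‖ ^ (-((Module.finrank ℝ E : ℝ) + s * p))) ∂μ := by
  rw [gagliardo_eq_lintegral_translateMass hu hp, lintegral_eq_tsum_annulus hr]
  refine tsum_congr fun k => ?_
  have h_kernel (h : E) : ENNReal.ofReal (‖(2 : ℝ) ^ k • h‖ ^ (-(Module.finrank ℝ E + s * p))) =
      2 ^ (-(k * (Module.finrank ℝ E + s * p))) *
        ENNReal.ofReal (‖h‖ ^ (-(Module.finrank ℝ E + s * p))) := by
    rw [norm_smul, norm_zpow, Real.norm_ofNat, Real.mul_rpow (by positivity) (norm_nonneg _),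
      ENNReal.ofReal_mul (by positivity), ← Real.rpow_intCast, ← Real.rpow_mul zero_le_two,
      ofReal_two_rpow, mul_neg]
  simp_rw [h_kernel, mul_left_comm (translateMass μ u p _)]
  rw [lintegral_const_mul' _ _ (by finiteness), ← mul_assoc, ← two_rpow_add]
  ring_nf

lemma gagliardo_le_dyadicSum [Nontrivial E] (hr : 1 ≤ r) (hu : AEStronglyMeasurable u μ)
    (hp : 0 ≤ p) (hs : 0 ≤ s) : gagliardo μ s p u ≤ dyadicSum (shellMass μ u p r) s p := by
  rw [gagliardo_eq_tsum (by linarith : 0 < r) hu hp, dyadicSum]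
  simp only [shellMass]
  gcongr ∑' k : ℤ, _ * ?_ with k
  refine setLIntegral_mono' measurableSet_annulus fun h hh => mul_le_of_le_one_right' ?_
  rw [ENNReal.ofReal_le_one]
  exact Real.rpow_le_one_of_one_le_of_nonpos (hr.trans hh.1.le)
    (neg_nonpos.2 (add_nonneg (Nat.cast_nonneg _) (mul_nonneg hs hp)))

lemma dyadicSum_le_gagliardo [Nontrivial E] (hr : 1 ≤ r) (hu : AEStronglyMeasurable u μ)
    (hp : 0 ≤ p) (hpP : p ≤ P) (hs₀ : 0 ≤ s) (hs₁ : s ≤ 1) :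
    dyadicSum (shellMass μ u p r) s p ≤
      ENNReal.ofReal ((2 * r) ^ (Module.finrank ℝ E + P)) * gagliardo μ s p u := by
  rw [gagliardo_eq_tsum (by linarith : 0 < r) hu hp, ← ENNReal.tsum_mul_left, dyadicSum]
  refine ENNReal.tsum_le_tsum fun k => ?_
  rw [mul_left_comm (ENNReal.ofReal _), shellMass, ← lintegral_const_mul' _ _ ENNReal.ofReal_ne_top]
  gcongr _ * ?_
  refine setLIntegral_mono' measurableSet_annulus fun h hh => ?_
  have h_pos : 0 < ‖h‖ := one_pos.trans (hr.trans_lt hh.1)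
  rw [mul_left_comm, ← ENNReal.ofReal_mul (by positivity)]
  refine le_mul_of_one_le_right' ?_
  rw [ENNReal.one_le_ofReal, Real.rpow_neg h_pos.le, ← div_eq_mul_inv,
    one_le_div (by positivity)]
  calc ‖h‖ ^ (Module.finrank ℝ E + s * p) ≤ (2 * r) ^ (Module.finrank ℝ E + s * p) := by
        gcongr
        exact hh.2
    _ ≤ (2 * r) ^ (Module.finrank ℝ E + P) :=
        Real.rpow_le_rpow_of_exponent_le (by linarith) (by nlinarith)

end Translation

/-! ### Translates of functions with a weak gradient -/

lemma locallyIntegrable_comp_add_right {E F : Type*} [NormedAddCommGroup E] [MeasurableSpace E]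
    [BorelSpace E] [NormedAddCommGroup F] {μ : Measure E} [μ.IsAddRightInvariant] {f : E → F}
    (hf : LocallyIntegrable f μ) (h : E) : LocallyIntegrable (fun x => f (x + h)) μ := by
  refine (locallyIntegrable_map_homeomorph (Homeomorph.addRight h) (μ := μ)).mp ?_
  rwa [Homeomorph.coe_addRight, map_add_right_eq_self]

lemma locallyIntegrable_inner_const {X E : Type*} [TopologicalSpace X] [MeasurableSpace X]
    {μ : Measure X} [NormedAddCommGroup E] [InnerProductSpace ℝ E] {G : X → E}
    (hG : LocallyIntegrable G μ) (h : E) : LocallyIntegrable (fun x => inner ℝ (G x) h) μ := by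
  intro x
  obtain ⟨s, hs, hGs⟩ := hG x
  exact ⟨s, hs, hGs.inner_const h⟩

lemma sub_eq_integral_fderiv {E F : Type*} [NormedAddCommGroup E] [NormedSpace ℝ E]
    [NormedAddCommGroup F] [NormedSpace ℝ F] [CompleteSpace F] {f : E → F} (hf : ContDiff ℝ 1 f)
    (x h : E) :
    f (x - h) - f x = ∫ t in Ioc (0 : ℝ) 1, -(fderiv ℝ f (x - t • h) h) := by
  have h_deriv (t : ℝ) :
      HasDerivAt (fun t : ℝ => f (x - t • h)) (-(fderiv ℝ f (x - t • h) h)) t := by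
    have h_line : HasDerivAt (fun t : ℝ => x - t • h) (-h) t := by
      simpa using ((hasDerivAt_id t).smul_const h).const_sub x
    rw [← map_neg]
    exact (hf.differentiable one_ne_zero (x - t • h)).hasFDerivAt.comp_hasDerivAt t h_line
  have h_cont : Continuous fun t : ℝ => -(fderiv ℝ f (x - t • h) h) :=
    (((hf.continuous_fderiv one_ne_zero).comp (by fun_prop)).clm_apply continuous_const).neg
  have h_ftc := intervalIntegral.integral_eq_sub_of_hasDerivAt (fun t _ => h_deriv t)
    (h_cont.intervalIntegrable 0 1)
  simpa only [intervalIntegral.integral_of_le zero_le_one, one_smul, zero_smul, sub_zero] using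
    h_ftc.symm

lemma lintegral_rpow_le_lintegral_rpow {α : Type*} [MeasurableSpace α] {μ : Measure α}
    [IsProbabilityMeasure μ] {f : α → ℝ≥0∞} (hf : AEMeasurable f μ) {p : ℝ} (hp : 1 ≤ p) :
    (∫⁻ x, f x ∂μ) ^ p ≤ ∫⁻ x, f x ^ p ∂μ := by
  have h := eLpNorm'_le_eLpNorm'_of_exponent_le one_pos hp μ hf.aestronglyMeasurable
  simp only [eLpNorm', enorm_eq_self, ENNReal.rpow_one, one_div, inv_one] at h
  rwa [ENNReal.le_rpow_inv_iff (by linarith)] at h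

section Segment

variable {E F : Type*} [NormedAddCommGroup E] [NormedSpace ℝ E] [MeasurableSpace E] [BorelSpace E]
  [NormedAddCommGroup F] {μ : Measure E} {f : E → F} {φ : E → ℝ}

lemma measurePreserving_prodMk_add_smul [SecondCountableTopology E] [SFinite μ]
    [μ.IsAddRightInvariant] (ν : Measure ℝ) [SFinite ν] (h : E) :
    MeasurePreserving (fun z : ℝ × E => (z.1, z.2 + z.1 • h)) (ν.prod μ) (ν.prod μ) :=
  (MeasurePreserving.id ν).skew_product (g := fun t x => x + t • h)
    (measurable_snd.add (measurable_fst.smul_const h))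
    (Eventually.of_forall fun t => map_add_right_eq_self μ (t • h))

variable [NormedSpace ℝ F]

lemma integrable_comp_sub_smul_smul [SecondCountableTopology E] [SFinite μ]
    (hf : LocallyIntegrable f μ) (hφ : Continuous φ) (hφc : HasCompactSupport φ) (h : E) :
    Integrable (fun z : ℝ × E => φ (z.2 - z.1 • h) • f z.2)
      ((volume.restrict (Ioc 0 1)).prod μ) := by
  obtain ⟨C, hC⟩ := hφc.exists_bound_of_continuous hφ
  set K : Set E := (fun z : ℝ × E => z.2 + z.1 • h) '' (Icc 0 1 ×ˢ tsupport φ)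
  have hK : IsCompact K := (isCompact_Icc.prod hφc.isCompact).image (by fun_prop)
  have hfK : Integrable (K.indicator f) μ :=
    (integrable_indicator_iff hK.measurableSet).2 (hf.integrableOn_isCompact hK)
  have hφ_meas : AEStronglyMeasurable (fun z : ℝ × E => φ (z.2 - z.1 • h))
      ((volume.restrict (Ioc 0 1)).prod μ) :=
    (hφ.comp (by fun_prop)).aestronglyMeasurable
  refine ((hfK.comp_snd _).bdd_smul C hφ_meas (Eventually.of_forall fun _ => hC _)).congr ?_
  filter_upwards [Measure.quasiMeasurePreserving_fst.ae (ae_restrict_mem measurableSet_Ioc)]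
    with z hz
  by_cases hzK : z.2 ∈ K
  · simp only [Pi.smul_apply', indicator_of_mem hzK]
  · have h_notMem : z.2 - z.1 • h ∉ tsupport φ := fun hmem =>
      hzK ⟨(z.1, z.2 - z.1 • h), ⟨Ioc_subset_Icc_self hz, hmem⟩, sub_add_cancel _ _⟩
    simp only [Pi.smul_apply', image_eq_zero_of_notMem_tsupport h_notMem, zero_smul]

lemma integrable_smul_comp_add_smul [SecondCountableTopology E] [SFinite μ]
    [μ.IsAddRightInvariant] (hf : LocallyIntegrable f μ) (hφ : Continuous φ)
    (hφc : HasCompactSupport φ) (h : E) :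
    Integrable (fun z : ℝ × E => φ z.2 • f (z.2 + z.1 • h))
      ((volume.restrict (Ioc 0 1)).prod μ) := by
  simpa only [Function.comp_def, add_sub_cancel_right] using
    (measurePreserving_prodMk_add_smul _ h).integrable_comp_of_integrable
      (integrable_comp_sub_smul_smul hf hφ hφc h)

lemma locallyIntegrable_integral_segment [FiniteDimensional ℝ E] [μ.IsAddHaarMeasure]
    (hf : LocallyIntegrable f μ) (h : E) :
    LocallyIntegrable (fun x => ∫ t in Ioc (0 : ℝ) 1, f (x + t • h)) μ := by
  have := FiniteDimensional.proper_real E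
  rw [locallyIntegrable_iff]
  intro K hK
  obtain ⟨φ, hφK, -, hφc, -⟩ := exists_continuous_one_zero_of_isCompact hK isClosed_empty
    (disjoint_empty K)
  refine ((integrable_smul_comp_add_smul hf φ.continuous hφc h).integral_prod_right.integrableOn
    (s := K)).congr_fun (fun x hx => ?_) hK.measurableSet
  simp only [hφK hx, Pi.one_apply, one_smul]

lemma lintegral_segment_rpow_le [SecondCountableTopology E] [SFinite μ] [μ.IsAddRightInvariant]
    {g : E → ℝ≥0∞} (hg : AEMeasurable g μ) {p : ℝ} (hp : 1 ≤ p) (h : E) :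
    ∫⁻ x, (∫⁻ t in Ioc (0 : ℝ) 1, g (x + t • h)) ^ p ∂μ ≤ ∫⁻ x, g x ^ p ∂μ := by
  have h_prob : IsProbabilityMeasure (volume.restrict (Ioc (0 : ℝ) 1)) := ⟨by simp⟩
  have hg_shear : AEMeasurable (fun z : ℝ × E => g (z.2 + z.1 • h))
      ((volume.restrict (Ioc 0 1)).prod μ) :=
    hg.comp_snd.comp_quasiMeasurePreserving
      (measurePreserving_prodMk_add_smul _ h).quasiMeasurePreserving
  calc ∫⁻ x, (∫⁻ t in Ioc (0 : ℝ) 1, g (x + t • h)) ^ p ∂μ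
      ≤ ∫⁻ x, (∫⁻ t in Ioc (0 : ℝ) 1, g (x + t • h) ^ p) ∂μ := by
        refine lintegral_mono_ae ?_
        filter_upwards [hg_shear.aestronglyMeasurable.prod_swap.prodMk_left] with x hx
        exact lintegral_rpow_le_lintegral_rpow hx.aemeasurable hp
    _ = ∫⁻ t in Ioc (0 : ℝ) 1, ∫⁻ x, g (x + t • h) ^ p ∂μ :=
        (lintegral_lintegral_swap (hg_shear.pow_const p)).symm
    _ = ∫⁻ x, g x ^ p ∂μ := by
        simp only [lintegral_add_right_eq_self fun x => g x ^ p, lintegral_const, measure_univ,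
          mul_one]

end Segment

section WeakGradient

variable {N : ℕ} {u φ : EuclideanSpace ℝ (Fin N) → ℝ}
  {G : EuclideanSpace ℝ (Fin N) → EuclideanSpace ℝ (Fin N)}

lemma IsTestFunction.comp_sub_const (hφ : IsTestFunction univ φ) (v : EuclideanSpace ℝ (Fin N)) :
    IsTestFunction univ fun x => φ (x - v) :=
  ⟨hφ.1.comp (contDiff_id.sub contDiff_const),
    hφ.2.1.comp_homeomorph (Homeomorph.subRight v), subset_univ _⟩

lemma IsTestFunction.integrable_mul (hφ : IsTestFunction univ φ) (hu : LocallyIntegrable u volume) :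
    Integrable (fun x => φ x * u x) volume :=
  hu.integrable_smul_left_of_hasCompactSupport hφ.1.continuous hφ.2.1

lemma IsTestFunction.integral_mul_sub (hφ : IsTestFunction univ φ)
    (hu : LocallyIntegrable u volume) (h : EuclideanSpace ℝ (Fin N)) :
    ∫ x, φ x * (u (x + h) - u x) = ∫ x, (φ (x - h) - φ x) * u x := by
  have h_shift : ∫ x, φ x * u (x + h) = ∫ x, φ (x - h) * u x := by
    simpa only [add_sub_cancel_right] using
      integral_add_right_eq_self (μ := volume) (fun x => φ (x - h) * u x) h
  simp_rw [mul_sub, sub_mul]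
  rw [integral_sub (hφ.integrable_mul (locallyIntegrable_comp_add_right hu h))
    (hφ.integrable_mul hu), integral_sub ((hφ.comp_sub_const h).integrable_mul hu)
    (hφ.integrable_mul hu), h_shift]

lemma HasWeakGradient.integral_fderiv_sub_mul (hG : HasWeakGradient u G)
    (hφ : IsTestFunction univ φ) (v w : EuclideanSpace ℝ (Fin N)) :
    ∫ x, -(fderiv ℝ φ (x - v) w) * u x = ∫ x, φ x * inner ℝ (G (x + v)) w := by
  have h_weak := hG.2.2 _ (hφ.comp_sub_const v) w
  simp only [fderiv_comp_sub] at h_weak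
  have h_shift : ∫ x, φ x * inner ℝ (G (x + v)) w = ∫ x, φ (x - v) * inner ℝ (G x) w := by
    simpa only [add_sub_cancel_right] using
      integral_add_right_eq_self (μ := volume) (fun x => φ (x - v) * inner ℝ (G x) w) v
  rw [h_shift, ← neg_eq_iff_eq_neg.mpr h_weak, ← integral_neg]
  simp only [mul_comm, mul_neg]

lemma HasWeakGradient.integral_mul_sub (hG : HasWeakGradient u G) (hφ : IsTestFunction univ φ)
    (h : EuclideanSpace ℝ (Fin N)) :
    ∫ x, φ x * (u (x + h) - u x) =
      ∫ x, φ x * ∫ t in Ioc (0 : ℝ) 1, inner ℝ (G (x + t • h)) h := by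
  have hψ : Continuous fun x => -(fderiv ℝ φ x h) :=
    ((hφ.1.continuous_fderiv (by simp)).clm_apply continuous_const).neg
  have hψc : HasCompactSupport fun x => -(fderiv ℝ φ x h) := (hφ.2.1.fderiv_apply ℝ h).neg
  calc ∫ x, φ x * (u (x + h) - u x)
      = ∫ x, ∫ t in Ioc (0 : ℝ) 1, -(fderiv ℝ φ (x - t • h) h) * u x := by
        rw [hφ.integral_mul_sub hG.1]
        simp only [sub_eq_integral_fderiv (hφ.1.of_le (by simp)), integral_mul_const]
    _ = ∫ t in Ioc (0 : ℝ) 1, ∫ x, -(fderiv ℝ φ (x - t • h) h) * u x :=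
        (integral_integral_swap (integrable_comp_sub_smul_smul hG.1 hψ hψc h)).symm
    _ = ∫ t in Ioc (0 : ℝ) 1, ∫ x, φ x * inner ℝ (G (x + t • h)) h := by
        simp only [hG.integral_fderiv_sub_mul hφ]
    _ = ∫ x, ∫ t in Ioc (0 : ℝ) 1, φ x * inner ℝ (G (x + t • h)) h :=
        integral_integral_swap (integrable_smul_comp_add_smul
          (locallyIntegrable_inner_const hG.2.1 h) hφ.1.continuous hφ.2.1 h)
    _ = _ := by simp only [integral_const_mul]

lemma HasWeakGradient.sub_ae_eq (hG : HasWeakGradient u G) (h : EuclideanSpace ℝ (Fin N)) :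
    ∀ᵐ x, u (x + h) - u x = ∫ t in Ioc (0 : ℝ) 1, inner ℝ (G (x + t • h)) h :=
  ae_eq_of_integral_contDiff_smul_eq ((locallyIntegrable_comp_add_right hG.1 h).sub hG.1)
    (locallyIntegrable_integral_segment (locallyIntegrable_inner_const hG.2.1 h) h)
    fun _ hφ hφc => hG.integral_mul_sub ⟨hφ, hφc, subset_univ _⟩ h

lemma HasWeakGradient.translateMass_le (hG : HasWeakGradient u G) {p : ℝ} (hp : 1 ≤ p)
    (h : EuclideanSpace ℝ (Fin N)) :
    translateMass volume u p h ≤ ‖h‖ₑ ^ p * ∫⁻ x, ‖G x‖ₑ ^ p := by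
  have hp₀ : 0 ≤ p := by linarith
  have h_inner := (locallyIntegrable_inner_const hG.2.1 h).aestronglyMeasurable
  calc translateMass volume u p h
      ≤ ∫⁻ x, (∫⁻ t in Ioc (0 : ℝ) 1, ‖inner ℝ (G (x + t • h)) h‖ₑ) ^ p := by
        refine lintegral_mono_ae ?_
        filter_upwards [hG.sub_ae_eq h] with x hx
        rw [hx]
        exact ENNReal.rpow_le_rpow (enorm_integral_le_lintegral_enorm _) hp₀
    _ ≤ ∫⁻ x, ‖inner ℝ (G x) h‖ₑ ^ p := lintegral_segment_rpow_le h_inner.enorm hp h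
    _ ≤ ∫⁻ x, ‖h‖ₑ ^ p * ‖G x‖ₑ ^ p := by
        refine lintegral_mono fun x => ?_
        rw [← ENNReal.mul_rpow_of_nonneg _ _ hp₀, mul_comm]
        exact ENNReal.rpow_le_rpow ((ENNReal.coe_le_coe.2 (nnnorm_inner_le_nnnorm _ _)).trans_eq
          (ENNReal.coe_mul _ _)) hp₀
    _ = ‖h‖ₑ ^ p * ∫⁻ x, ‖G x‖ₑ ^ p := lintegral_const_mul' _ _ (by finiteness)

end WeakGradient

/-! ### Comparison of the seminorms of different orders -/

lemma exists_Gamma_bounds {a : ℝ} (ha : 0 < a) (b : ℝ) :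
    ∃ m M : ℝ, 0 < m ∧ ∀ x ∈ Icc a b, m ≤ Real.Gamma x ∧ Real.Gamma x ≤ M := by
  have h_pos : ∀ x ∈ Icc a b, 0 < x := fun x hx => ha.trans_le hx.1
  have h_cont : ContinuousOn Real.Gamma (Icc a b) := fun x hx =>
    (Real.differentiableAt_Gamma fun m => ((neg_nonpos.mpr m.cast_nonneg).trans_lt
      (h_pos x hx)).ne').continuousAt.continuousWithinAt
  obtain ⟨m, hm, h_le⟩ := isCompact_Icc.exists_forall_le' h_cont
    fun x hx => Real.Gamma_pos_of_pos (h_pos x hx)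
  obtain ⟨M, hM⟩ := isCompact_Icc.exists_bound_of_continuousOn h_cont
  exact ⟨m, M, hm, fun x hx => ⟨h_le x hx, (le_abs_self _).trans (hM x hx)⟩⟩

lemma cNsp_eq (N : ℕ) {s : ℝ} (hs : s < 1) (p : ℝ) :
    cNsp N s p = s * (1 - s) * ((2 : ℝ) ^ (2 * s) * Real.Gamma ((p * s + p + N - 2) / 2) /
      (Real.pi ^ ((N : ℝ) / 2) * Real.Gamma (2 - s))) := by
  have hs' : 0 < 1 - s := by linarith
  have hΓ : Real.Gamma (2 - s) = (1 - s) * Real.Gamma (1 - s) := by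
    rw [← Real.Gamma_add_one hs'.ne']
    ring_nf
  rw [cNsp, hΓ]
  have := Real.Gamma_pos_of_pos hs'
  field_simp

lemma exists_cNsp_bounds {N : ℕ} (hN : 2 ≤ N) (P : ℝ) :
    ∃ a b : ℝ, 0 < a ∧ 0 < b ∧ ∀ s p : ℝ, 0 < s → s < 1 → 1 ≤ p → p ≤ P →
      s * (1 - s) ≤ a * cNsp N s p ∧ cNsp N s p ≤ b * (s * (1 - s)) := by
  have hN' : (2 : ℝ) ≤ N := by exact_mod_cast hN
  obtain ⟨m, M, hm, hΓ⟩ := exists_Gamma_bounds one_half_pos (max 2 (P + N))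
  have hM : 0 < M := hm.trans_le ((hΓ 1 ⟨by norm_num, by simp⟩).1.trans
    (hΓ 1 ⟨by norm_num, by simp⟩).2)
  set c := Real.pi ^ ((N : ℝ) / 2)
  have : 0 < c := by positivity
  refine ⟨c * M / m, 4 * M / (c * m), by positivity, by positivity, fun s p hs₀ hs₁ hp hpP => ?_⟩
  obtain ⟨hA, hA'⟩ := hΓ ((p * s + p + N - 2) / 2)
    ⟨by nlinarith, le_max_of_le_right (by nlinarith)⟩
  obtain ⟨hB, hB'⟩ := hΓ (2 - s) ⟨by linarith, le_max_of_le_left (by linarith)⟩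
  have h_two : (2 : ℝ) ^ (2 * s) ≤ 4 := by
    calc (2 : ℝ) ^ (2 * s) ≤ 2 ^ (2 : ℝ) :=
          Real.rpow_le_rpow_of_exponent_le one_le_two (by linarith)
      _ = 4 := by norm_num
  have h_one : 1 ≤ (2 : ℝ) ^ (2 * s) := Real.one_le_rpow one_le_two (by linarith)
  have hA₀ := hm.trans_le hA
  have hB₀ := hm.trans_le hB
  have hs : 0 ≤ s * (1 - s) := mul_nonneg hs₀.le (by linarith)
  rw [cNsp_eq N hs₁, mul_left_comm, mul_comm _ (s * (1 - s))]
  refine ⟨le_mul_of_one_le_right hs ?_, by gcongr⟩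
  rw [div_mul_div_comm, one_le_div (by positivity)]
  calc m * (c * Real.Gamma (2 - s)) ≤ Real.Gamma ((p * s + p + N - 2) / 2) * (c * M) := by gcongr
    _ ≤ 2 ^ (2 * s) * (Real.Gamma ((p * s + p + N - 2) / 2) * (c * M)) :=
        le_mul_of_one_le_left (by positivity) h_one
    _ = c * M * (2 ^ (2 * s) * Real.Gamma ((p * s + p + N - 2) / 2)) := by ring

section Seminorm

variable {N : ℕ} {u : EuclideanSpace ℝ (Fin N) → ℝ} {s S p P r : ℝ}

lemma fracSeminorm_zero_rpow (hp : 0 < p) : fracSeminorm 0 p u ^ p = ∫⁻ x, ‖u x‖ₑ ^ p := by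
  rw [fracSeminorm, if_pos rfl, eLpNorm_eq_lintegral_rpow_enorm_toReal (by simpa using hp)
    ENNReal.ofReal_ne_top, ENNReal.toReal_ofReal hp.le, one_div, ENNReal.rpow_inv_rpow hp.ne']

lemma fracSeminorm_rpow (hs₀ : 0 < s) (hs₁ : s < 1) (hp : 0 < p) :
    fracSeminorm s p u ^ p = ENNReal.ofReal (cNsp N s p) * gagliardo volume s p u := by
  simp only [fracSeminorm, if_neg hs₀.ne', if_neg hs₁.ne, one_div, ENNReal.rpow_inv_rpow hp.ne',
    gagliardo, finrank_euclideanSpace_fin, Measure.volume_eq_prod, Real.norm_eq_abs]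

lemma le_mul_fracSeminorm_one_rpow {m C : ℝ≥0∞} (hp : 0 < p) (hC₀ : C ≠ 0) (hC : C ≠ ⊤)
    (h : ∀ G, HasWeakGradient u G → m ≤ C * ∫⁻ x, ‖G x‖ₑ ^ p) :
    m ≤ C * fracSeminorm 1 p u ^ p := by
  rw [← ENNReal.div_le_iff' hC₀ hC, ← ENNReal.rpow_inv_le_iff hp, fracSeminorm,
    if_neg one_ne_zero, if_pos rfl, gradNorm]
  refine le_iInf₂ fun G hG => ?_
  rw [eLpNorm_eq_lintegral_rpow_enorm_toReal (by simpa using hp) ENNReal.ofReal_ne_top,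
    ENNReal.toReal_ofReal hp.le, one_div]
  exact ENNReal.rpow_le_rpow (ENNReal.div_le_of_le_mul' (h G hG)) (by positivity)

lemma shellMean_one_le (hr : 1 ≤ r) (hu : AEStronglyMeasurable u volume) (hp : 1 ≤ p) (hpP : p ≤ P)
    {G : EuclideanSpace ℝ (Fin N) → EuclideanSpace ℝ (Fin N)} (hG : HasWeakGradient u G) :
    shellMean volume u p r 1 ≤ volume (annulus (EuclideanSpace ℝ (Fin N)) r) *
      (ENNReal.ofReal (2 * r) ^ P * ∫⁻ x, ‖G x‖ₑ ^ p) :=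
  dyadicMean_one_le (monotone_smallScales (shellMass_succ_le hu hp))
    (smallScales_shellMass_le (by linarith) hpP hr (hG.translateMass_le hp))

lemma nontrivial_euclideanSpace_fin (hN : 2 ≤ N) : Nontrivial (EuclideanSpace ℝ (Fin N)) :=
  Module.nontrivial_of_finrank_pos (R := ℝ) (by rw [finrank_euclideanSpace_fin]; omega)

lemma exists_fracSeminorm_rpow_le_shellMean (hN : 2 ≤ N) (hr : 1 ≤ r) (P : ℝ) :
    ∃ C : ℝ≥0∞, C ≠ ⊤ ∧ ∀ (s p : ℝ) (u : EuclideanSpace ℝ (Fin N) → ℝ), 0 ≤ s → s < 1 →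
      1 ≤ p → p ≤ P → AEStronglyMeasurable u volume →
      fracSeminorm s p u ^ p ≤ C * shellMean volume u p r s := by
  have := nontrivial_euclideanSpace_fin hN
  obtain ⟨_, b, _, _, h_c⟩ := exists_cNsp_bounds hN P
  set α := volume (annulus (EuclideanSpace ℝ (Fin N)) r)
  have hα₀ : α ≠ 0 := measure_annulus_ne_zero (by linarith)
  have hα : α ≠ ⊤ := measure_annulus_ne_top
  refine ⟨α⁻¹ + ENNReal.ofReal b * (2 * 2 ^ P), by finiteness, fun s p u hs₀ hs₁ hp hpP hu => ?_⟩
  have hp₀ : 0 < p := by linarith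
  rw [add_mul]
  rcases hs₀.eq_or_lt with rfl | hs₀
  · refine le_add_right ?_
    rw [fracSeminorm_zero_rpow hp₀, shellMean, dyadicMean_zero, ENNReal.inv_mul_cancel_left hα₀ hα]
  · refine le_add_left ?_
    calc fracSeminorm s p u ^ p
        ≤ ENNReal.ofReal (b * (s * (1 - s))) * dyadicSum (shellMass volume u p r) s p := by
          rw [fracSeminorm_rpow hs₀ hs₁ hp₀]
          gcongr
          · exact (h_c s p hs₀ hs₁ hp hpP).2
          · exact gagliardo_le_dyadicSum hr hu hp₀.le hs₀.le
      _ = ENNReal.ofReal b *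
            (ENNReal.ofReal (s * (1 - s)) * dyadicSum (shellMass volume u p r) s p) := by
          rw [ENNReal.ofReal_mul' (mul_nonneg hs₀.le (by linarith)), mul_assoc]
      _ ≤ ENNReal.ofReal b * (2 * 2 ^ P * shellMean volume u p r s) := by
          gcongr _ * ?_
          exact ofReal_mul_dyadicSum_le hp (by linarith) hs₀ hs₁ (shellMass_succ_le hu hp)
            fun n => shellMass_le hu hp hpP n
      _ = ENNReal.ofReal b * (2 * 2 ^ P) * shellMean volume u p r s := by rw [← mul_assoc]

lemma exists_shellMean_le_fracSeminorm_rpow (hN : 2 ≤ N) (hr : 1 ≤ r) (P : ℝ) :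
    ∃ C : ℝ≥0∞, C ≠ ⊤ ∧ ∀ (s p : ℝ) (u : EuclideanSpace ℝ (Fin N) → ℝ), 0 < s → s ≤ 1 →
      1 ≤ p → p ≤ P → AEStronglyMeasurable u volume → (∀ᵐ x, r / 2 ≤ ‖x‖ → u x = 0) →
      shellMean volume u p r s ≤ C * fracSeminorm s p u ^ p := by
  have := nontrivial_euclideanSpace_fin hN
  obtain ⟨a, _, ha, _, h_c⟩ := exists_cNsp_bounds hN P
  set α := volume (annulus (EuclideanSpace ℝ (Fin N)) r)
  have hα₀ : α ≠ 0 := measure_annulus_ne_zero (by linarith)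
  have hα : α ≠ ⊤ := measure_annulus_ne_top
  have h_2r : 0 < ENNReal.ofReal (2 * r) := ENNReal.ofReal_pos.2 (by linarith)
  set C₁ := α * ENNReal.ofReal (2 * r) ^ P
  set C₂ := ENNReal.ofReal P * 2 ^ P * (ENNReal.ofReal a * ENNReal.ofReal ((2 * r) ^ (N + P)))
  have hC₁₀ : C₁ ≠ 0 := mul_ne_zero hα₀ (ENNReal.rpow_pos h_2r ENNReal.ofReal_ne_top).ne'
  have hC₁ : C₁ ≠ ⊤ :=
    ENNReal.mul_ne_top hα (ENNReal.rpow_ne_top_of_ne_zero h_2r.ne' ENNReal.ofReal_ne_top)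
  refine ⟨C₁ + C₂, by finiteness, fun s p u hs₀ hs₁ hp hpP hu hu₀ => ?_⟩
  have hp₀ : 0 < p := by linarith
  rw [add_mul]
  rcases hs₁.eq_or_lt with rfl | hs₁
  · refine le_add_right (le_mul_fracSeminorm_one_rpow hp₀ hC₁₀ hC₁ fun G hG => ?_)
    exact (shellMean_one_le hr hu hp hpP hG).trans_eq (mul_assoc _ _ _).symm
  · refine le_add_left ?_
    calc shellMean volume u p r s
        ≤ ENNReal.ofReal P * 2 ^ P *
            (ENNReal.ofReal (s * (1 - s)) * dyadicSum (shellMass volume u p r) s p) :=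
          dyadicMean_le hp₀ hpP hs₀ hs₁ (shellMass_succ_le hu hp) (le_shellMass hp₀ hu₀)
      _ ≤ ENNReal.ofReal P * 2 ^ P * (ENNReal.ofReal (a * cNsp N s p) *
            (ENNReal.ofReal ((2 * r) ^ (N + P)) * gagliardo volume s p u)) := by
          gcongr _ * (ENNReal.ofReal ?_ * ?_)
          · exact (h_c s p hs₀ hs₁ hp hpP).1
          · simpa only [finrank_euclideanSpace_fin] using
              dyadicSum_le_gagliardo hr hu hp₀.le hpP hs₀.le hs₁.le
      _ = C₂ * fracSeminorm s p u ^ p := by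
          rw [fracSeminorm_rpow hs₀ hs₁ hp₀, ENNReal.ofReal_mul ha.le]
          ring

lemma exists_fracSeminorm_rpow_le (hN : 2 ≤ N) {Ω : Set (EuclideanSpace ℝ (Fin N))}
    (hΩ : Bornology.IsBounded Ω) (P : ℝ) :
    ∃ C : ℝ≥0∞, C ≠ ⊤ ∧ ∀ (s S p : ℝ) (u : EuclideanSpace ℝ (Fin N) → ℝ),
      0 ≤ s → s < S → S ≤ 1 → 1 ≤ p → p ≤ P →
      AEStronglyMeasurable u volume → (∀ᵐ x, x ∉ Ω → u x = 0) →
      fracSeminorm s p u ^ p ≤ C * fracSeminorm S p u ^ p := by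
  obtain ⟨R, hR, hΩR⟩ := hΩ.subset_ball_lt (1 / 2) (0 : EuclideanSpace ℝ (Fin N))
  obtain ⟨C₁, hC₁, h_le_mean⟩ := exists_fracSeminorm_rpow_le_shellMean hN (r := 2 * R)
    (by linarith) P
  obtain ⟨C₂, hC₂, h_mean_le⟩ := exists_shellMean_le_fracSeminorm_rpow hN (r := 2 * R)
    (by linarith) P
  refine ⟨C₁ * C₂, by finiteness, fun s S p u hs hsS hS hp hpP hu hu₀ => ?_⟩
  have hu_ball : ∀ᵐ x, 2 * R / 2 ≤ ‖x‖ → u x = 0 := by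
    filter_upwards [hu₀] with x hx hxR
    refine hx fun hxΩ => (mem_ball_zero_iff.1 (hΩR hxΩ)).not_ge ?_
    linarith
  calc fracSeminorm s p u ^ p ≤ C₁ * shellMean volume u p (2 * R) s :=
        h_le_mean s p u hs (hsS.trans_le hS) hp hpP hu
    _ ≤ C₁ * shellMean volume u p (2 * R) S := by
        gcongr
        exact shellMean_mono (by linarith) hu_ball hs hsS.le hS
    _ ≤ C₁ * (C₂ * fracSeminorm S p u ^ p) := by
        gcongr
        exact h_mean_le S p u (hs.trans_lt hsS) hS hp hpP hu hu_ball
    _ = C₁ * C₂ * fracSeminorm S p u ^ p := (mul_assoc _ _ _).symm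

end Seminorm

/-! ### Integration against product measures -/

section Superposition

variable {α β : Type*} [MeasurableSpace α] [MeasurableSpace β] {μ ν : Measure α}

lemma setLIntegral_prod_le_of_le {ρ : Measure β} [SFinite μ] [SFinite ν] [SFinite ρ]
    {A B : Set α} {I : Set β} (hA : MeasurableSet A) (hB : MeasurableSet B) (hI : MeasurableSet I)
    {F : α × β → ℝ≥0∞} {C γ : ℝ≥0∞} (hC : C ≠ ⊤)
    (hF : ∀ s ∈ A, ∀ S ∈ B, ∀ p ∈ I, F (s, p) ≤ C * F (S, p)) (hAB : ν A ≤ γ * μ B) :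
    ∫⁻ z in A ×ˢ I, F z ∂(ν.prod ρ) ≤ C * γ * ∫⁻ z in B ×ˢ I, F z ∂(μ.prod ρ) := by
  set f : β → ℝ≥0∞ := fun p => ⨆ s ∈ A, F (s, p)
  -- `F` need not be measurable, so `f` is replaced by a measurable minorant with the same integral.
  obtain ⟨g, hg, hgf, hfg⟩ := exists_measurable_le_lintegral_eq (ρ.restrict I) f
  have h_upper : ∫⁻ z in A ×ˢ I, F z ∂(ν.prod ρ) ≤ ν A * ∫⁻ p in I, f p ∂ρ := by
    calc ∫⁻ z in A ×ˢ I, F z ∂(ν.prod ρ) ≤ ∫⁻ z in A ×ˢ I, f z.2 ∂(ν.prod ρ) :=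
          setLIntegral_mono' (hA.prod hI) fun z hz =>
            le_iSup₂_of_le (f := fun s _ => F (s, z.2)) z.1 hz.1 le_rfl
      _ ≤ ∫⁻ _ in A, ∫⁻ p in I, f p ∂ρ ∂ν := by
          rw [← Measure.prod_restrict]
          exact lintegral_prod_le _
      _ = ν A * ∫⁻ p in I, f p ∂ρ := by rw [setLIntegral_const, mul_comm]
  have h_lower : μ B * ∫⁻ p in I, f p ∂ρ ≤ C * ∫⁻ z in B ×ˢ I, F z ∂(μ.prod ρ) := by
    calc μ B * ∫⁻ p in I, f p ∂ρ = ∫⁻ z in B ×ˢ I, g z.2 ∂(μ.prod ρ) := by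
          rw [← Measure.prod_restrict, lintegral_prod (fun z => g z.2)
            (hg.comp measurable_snd).aemeasurable, hfg, mul_comm]
          simp only [setLIntegral_const]
      _ ≤ ∫⁻ z in B ×ˢ I, C * F z ∂(μ.prod ρ) :=
          setLIntegral_mono' (hB.prod hI) fun z hz =>
            (hgf z.2).trans (iSup₂_le fun s hs => hF s hs z.1 hz.1 z.2 hz.2)
      _ = C * ∫⁻ z in B ×ˢ I, F z ∂(μ.prod ρ) := lintegral_const_mul' _ _ hC
  calc ∫⁻ z in A ×ˢ I, F z ∂(ν.prod ρ) ≤ γ * μ B * ∫⁻ p in I, f p ∂ρ :=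
        h_upper.trans (by gcongr)
    _ = γ * (μ B * ∫⁻ p in I, f p ∂ρ) := mul_assoc _ _ _
    _ ≤ γ * (C * ∫⁻ z in B ×ˢ I, F z ∂(μ.prod ρ)) := by gcongr
    _ = C * γ * ∫⁻ z in B ×ˢ I, F z ∂(μ.prod ρ) := by ring

variable [IsFiniteMeasure μ] [IsFiniteMeasure ν] {A : Set α}

lemma signedIntegral_sub_of_null (hA : MeasurableSet A) (hν : ν A = 0) (f : α → ℝ≥0∞) :
    signedIntegral (μ.toSignedMeasure - ν.toSignedMeasure) A f =
      ((∫⁻ z in A, f z ∂μ : ℝ≥0∞) : EReal) := by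
  rw [signedIntegral, Measure.toJordanDecomposition_toSignedMeasure_sub,
    Measure.jordanDecompositionOfToSignedMeasureSub_posPart,
    Measure.jordanDecompositionOfToSignedMeasureSub_negPart,
    Measure.restrict_sub_eq_restrict_sub_restrict hA,
    Measure.restrict_sub_eq_restrict_sub_restrict hA, Measure.restrict_eq_zero.2 hν,
    Measure.sub_zero, Measure.zero_sub, lintegral_zero_measure, EReal.coe_ennreal_zero, sub_zero]

lemma coe_le_coe_mul_signedIntegral (hA : MeasurableSet A) (hν : ν A = 0) {c : ℝ} (hc : 0 ≤ c)
    {x : ℝ≥0∞} {f : α → ℝ≥0∞} (hx : x ≤ ENNReal.ofReal c * ∫⁻ z in A, f z ∂μ) :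
    (x : EReal) ≤ (c : EReal) * signedIntegral (μ.toSignedMeasure - ν.toSignedMeasure) A f := by
  have hc_coe : (c : EReal) = (ENNReal.ofReal c : ℝ≥0∞) := by
    rw [EReal.coe_ennreal_ofReal, max_eq_left hc]
  rw [signedIntegral_sub_of_null hA hν, hc_coe, ← EReal.coe_ennreal_mul]
  exact EReal.coe_ennreal_le_coe_ennreal_iff.2 hx

end Superposition

theorem theorem2p6_general {N : ℕ} (hN : 2 ≤ N) {Ω : Set (EuclideanSpace ℝ (Fin N))}
    (hΩ : Bornology.IsBounded Ω) (P : ℝ) :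
    ∃ c₀ : ℝ, 0 < c₀ ∧
      ∀ (σplus σminus ρ : Measure ℝ) [SFinite σplus] [SFinite σminus] [SFinite ρ] (sbar : ℝ)
        (γ : ℝ≥0∞) (I : Set ℝ), MeasurableSet I → I ⊆ Icc 1 P →
        σminus (Ico 0 sbar) ≤ γ * σplus (Icc sbar 1) →
        ∀ u : EuclideanSpace ℝ (Fin N) → ℝ,
          AEStronglyMeasurable u volume → (∀ᵐ x, x ∉ Ω → u x = 0) →
          ∫⁻ z in Ico 0 sbar ×ˢ I, fracSeminorm z.1 z.2 u ^ z.2 ∂(σminus.prod ρ) ≤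
            ENNReal.ofReal c₀ * γ *
              ∫⁻ z in Icc sbar 1 ×ˢ I, fracSeminorm z.1 z.2 u ^ z.2 ∂(σplus.prod ρ) := by
  obtain ⟨C, hC, h_mono⟩ := exists_fracSeminorm_rpow_le hN hΩ P
  refine ⟨C.toReal + 1, by positivity, ?_⟩
  intro σplus σminus ρ _ _ _ sbar γ I hI hIP hγ u hu hu₀
  refine setLIntegral_prod_le_of_le measurableSet_Ico measurableSet_Icc hI ENNReal.ofReal_ne_top
    (fun s hs S hS p hp => ?_) hγ
  calc fracSeminorm s p u ^ p ≤ C * fracSeminorm S p u ^ p :=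
        h_mono s S p u hs.1 (hs.2.trans_le hS.1) hS.2 (hIP hp).1 (hIP hp).2 hu hu₀
    _ ≤ ENNReal.ofReal (C.toReal + 1) * fracSeminorm S p u ^ p := by
        gcongr
        exact (ENNReal.le_ofReal_iff_toReal_le hC (by positivity)).2 (by linarith)

theorem theorem2p6 (N : ℕ) (hN : 2 ≤ N) (Ω : Set (EuclideanSpace ℝ (Fin N)))
    (hΩ_open : IsOpen Ω) (hΩ_bdd : Bornology.IsBounded Ω) :
    ∃ c₀ : ℝ, 0 < c₀ ∧
      ∀ (μplus μminus : Measure (ℝ × ℝ)) [IsFiniteMeasure μplus] [IsFiniteMeasure μminus]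
        (μsplus μsminus μp : Measure ℝ)
        [IsFiniteMeasure μsplus] [IsFiniteMeasure μsminus] [IsFiniteMeasure μp]
        (sbar γ δ η : ℝ),
        -- the factors are measures on `[0,1]` and on `(1,N)`
        μsplus (Icc 0 1)ᶜ = 0 → μsminus (Icc 0 1)ᶜ = 0 → μp (Ioo 1 (N : ℝ))ᶜ = 0 →
        -- product structure
        μplus = μsplus.prod μp → μminus = μsminus.prod μp →
        0 < sbar → sbar ≤ 1 → 0 ≤ γ → 0 < δ → 0 < η →
        0 < μplus (Icc sbar 1 ×ˢ Ioo 1 (N : ℝ)) →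
        μminus (Icc sbar 1 ×ˢ Ioo 1 (N : ℝ)) = 0 →
        μsminus (Ico 0 sbar) ≤ ENNReal.ofReal γ * μsplus (Icc sbar 1) →
        μp.support ⊆ Icc (1 + δ) ((N : ℝ) - η) →
        ∀ u ∈ spaceX Ω μplus,
          ((∫⁻ z in Ico 0 sbar ×ˢ Ioo 1 (N : ℝ),
              fracSeminorm z.1 z.2 u ^ z.2 ∂μminus : ℝ≥0∞) : EReal) ≤
            ((c₀ * γ : ℝ) : EReal) *
              signedIntegral (μplus.toSignedMeasure - μminus.toSignedMeasure)
                (Icc sbar 1 ×ˢ Ioo 1 (N : ℝ)) (fun z => fracSeminorm z.1 z.2 u ^ z.2) := by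
  obtain ⟨c₀, hc₀, h_le⟩ := theorem2p6_general hN hΩ_bdd N
  refine ⟨c₀, hc₀, ?_⟩
  rintro _ _ _ _ μsplus μsminus μp _ _ _ sbar γ - - - - - rfl rfl - - hγ - - - hnull hdom - u
    ⟨hu, hu₀, -⟩
  exact coe_le_coe_mul_signedIntegral (measurableSet_Icc.prod measurableSet_Ioo) hnull
    (mul_nonneg hc₀.le hγ) (ENNReal.ofReal_mul (q := γ) hc₀.le ▸
      h_le μsplus μsminus μp sbar _ _ measurableSet_Ioo Ioo_subset_Icc_self hdom u hu hu₀)
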